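/- Let $G$ be a compact Hausdorff topological group, let $X$ be a metrizable $G$-space (a metrizable space with a continuous action $G\times X\to X$), and let $A\subseteq X$ be a $G$-subset (i.e. a $G$-invariant subset). A $G$-map is a continuous $G$-equivariant map, and a $G$-neighbourhood of a set is a $G$-invariant neighbourhood of it. Use the following terminology. - $X$ is a $G$-AR (resp. a $G$-ANR) if for every closed $G$-embedding $i:X\to Y$ (a $G$-map that is a homeomorphism onto a closed subset) into a metrizable $G$-space $Y$, there is a $G$-map $r:Y\to i(X)$ (resp. $r:U\to i(X)$ for some $G$-neighbourhood $U$ of $i(X)$ in $Y$) with $r(y)=y$ for all $y\in i(X)$. - $(X,A)$ is a $G$-ANR-pair if for every metrizable $G$-space $Z$, every closed $G$-subset $B\subseteq Z$ and every $G$-map $f:B\to X$ there are a $G$-neighbourhood $U$ of $B$ in $Z$ and a $G$-map $F:U\to X$ with $F|_B=f$ and $F(U\setminus B)\subseteq A$. It is a $G$-AR-pair if one can always take $U=Z$. - $A$ is $G$-homotopy dense in $X$ if there is a continuous map $F:X\times[0,1]\to X$ with $F(gx,t)=gF(x,t)$ and $F(x,0)=x$ for all $g\in G$, $x\in X$, $t\in[0,1]$,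 and $F(X\times(0,1])\subseteq A$. **Theorem 3.3.** $(X,A)$ is a $G$-AR-pair (resp. a $G$-ANR-pair) if and only if $X$ is a $G$-AR (resp. a $G$-ANR) and $A$ is $G$-homotopy dense in $X$. -/

import Mathlib

open Topology TopologicalSpace

universe u v

/-- The image of an equivariant map, as an invariant subset of the target. -/
def gImage {G : Type v} [Group G] {X Y : Type u} [MulAction G X] [MulAction G Y]
    (i : X →[G] Y) : SubMulAction G Y where
  carrier := Set.range i
  smul_mem' := by
    rintro g _ ⟨x, rfl⟩
    exact ⟨g • x, map_smul i g x⟩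

/-- The invariant subset `A` of the `G`-space `Y` is a `G`-retract of `Y`. -/
def IsGRetract {G : Type v} [Group G] {Y : Type u} [TopologicalSpace Y] [MulAction G Y]
    (A : SubMulAction G Y) : Prop :=
  ∃ r : Y →[G] A, Continuous r ∧ ∀ a : A, r (a : Y) = a

/-- The invariant subset `A` of the `G`-space `Y` is a neighbourhood `G`-retract of `Y`: it is a
`G`-retract of some invariant neighbourhood `U` of `A` (the neighbourhood need not be open). -/
def IsNhdGRetract {G : Type v} [Group G] {Y : Type u} [TopologicalSpace Y] [MulAction G Y]
    (A : SubMulAction G Y) : Prop :=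
  ∃ U : SubMulAction G Y, (U : Set Y) ∈ 𝓝ˢ (A : Set Y) ∧
    ∃ r : U →[G] A, Continuous r ∧ ∀ (y : Y) (hU : y ∈ U) (hA : y ∈ A), r ⟨y, hU⟩ = ⟨y, hA⟩

/-- `X` is a `G`-AR: under every closed `G`-embedding into a metrizable `G`-space, the image of `X`
is a `G`-retract. Metrizability of `X` itself is a separate assumption where this is used. -/
def IsGAR (G : Type v) [Group G] [TopologicalSpace G]
    (X : Type u) [TopologicalSpace X] [MulAction G X] : Prop :=
  ∀ (Y : Type u) [TopologicalSpace Y] [MetrizableSpace Y] [MulAction G Y] [ContinuousSMul G Y]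
    (i : X →[G] Y), IsClosedEmbedding i → IsGRetract (gImage i)

/-- `X` is a `G`-ANR: under every closed `G`-embedding into a metrizable `G`-space, the image of `X`
is a neighbourhood `G`-retract. -/
def IsGANR (G : Type v) [Group G] [TopologicalSpace G]
    (X : Type u) [TopologicalSpace X] [MulAction G X] : Prop :=
  ∀ (Y : Type u) [TopologicalSpace Y] [MetrizableSpace Y] [MulAction G Y] [ContinuousSMul G Y]
    (i : X →[G] Y), IsClosedEmbedding i → IsNhdGRetract (gImage i)

/-- `(X, A)` is a `G`-AR-pair: every `G`-map `f : B → X` from a closed invariant subset `B` of a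
metrizable `G`-space `Z` extends to a `G`-map `F : Z → X` with `F (Z \ B) ⊆ A`. -/
def IsGARPair {G : Type v} [Group G] [TopologicalSpace G]
    {X : Type u} [TopologicalSpace X] [MulAction G X] (A : SubMulAction G X) : Prop :=
  ∀ (Z : Type u) [TopologicalSpace Z] [MetrizableSpace Z] [MulAction G Z] [ContinuousSMul G Z]
    (B : SubMulAction G Z), IsClosed (B : Set Z) →
    ∀ f : B →[G] X, Continuous f →
      ∃ F : Z →[G] X, Continuous F ∧ (∀ b : B, F (b : Z) = f b) ∧ ∀ z : Z, z ∉ B → F z ∈ A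

/-- `(X, A)` is a `G`-ANR-pair: every `G`-map `f : B → X` from a closed invariant subset `B` of a
metrizable `G`-space `Z` extends to a `G`-map `F : U → X` on some invariant neighbourhood `U`
of `B` in `Z`, with `F (U \ B) ⊆ A`. -/
def IsGANRPair {G : Type v} [Group G] [TopologicalSpace G]
    {X : Type u} [TopologicalSpace X] [MulAction G X] (A : SubMulAction G X) : Prop :=
  ∀ (Z : Type u) [TopologicalSpace Z] [MetrizableSpace Z] [MulAction G Z] [ContinuousSMul G Z]
    (B : SubMulAction G Z), IsClosed (B : Set Z) →
    ∀ f : B →[G] X, Continuous f →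
      ∃ U : SubMulAction G Z, (U : Set Z) ∈ 𝓝ˢ (B : Set Z) ∧
        ∃ F : U →[G] X, Continuous F ∧
          (∀ (z : Z) (hU : z ∈ U) (hB : z ∈ B), F ⟨z, hU⟩ = f ⟨z, hB⟩) ∧
          ∀ z : U, (z : Z) ∉ B → F z ∈ A

/-- The invariant subset `A` is `G`-homotopy dense in `X`: there is a `G`-homotopy
`F : X × [0, 1] → X` (with `G` acting by `g • (x, t) = (g • x, t)`) such that `F (x, 0) = x`
and `F (x, t) ∈ A` for `t ∈ (0, 1]`. -/
def IsGHomotopyDense {G : Type v} [Group G]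
    {X : Type u} [TopologicalSpace X] [MulAction G X] (A : SubMulAction G X) : Prop :=
  ∃ F : X × unitInterval → X, Continuous F ∧
    (∀ (g : G) (x : X) (t : unitInterval), F (g • x, t) = g • F (x, t)) ∧
    (∀ x : X, F (x, 0) = x) ∧
    ∀ (x : X) (t : unitInterval), 0 < t → F (x, t) ∈ A

/-! The core is an extension property of a `G`-A(N)R `X`: a `G`-map `f : B → X` on a closed
invariant `B ⊆ Z` extends to `Z`, or to a neighbourhood of `B`. Embed `X` in a Banach space `E`,
extend `f` to `φ : Z → E` by Dugundji, and add a coordinate `t` in `[0, 1]` vanishing exactly on `B`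
(and on all of `X`). Passing to functions on `G` makes the maps equivariant. The images of `X` and
`Z` together form a metrizable `G`-space in which `X` is closed, so a retraction onto `X` gives the
extension `F`. If `H` is a homotopy witnessing density, `z ↦ H (F z, t z)` still extends `f` and
sends the complement of `B` into `A`. Conversely, the pair property applied to `X × {0} ⊆ X × [0,
1]` gives the homotopy near time `0`; rescaling time by an invariant positive function makes it
global. -/

open Set Metric
open scoped BoundedContinuousFunction

/-! ### Extension and embedding theorems without a group action -/

section Dugundji

variable {Z E : Type*} [TopologicalSpace Z] [MetrizableSpace Z]
  [NormedAddCommGroup E] [NormedSpace ℝ E]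

/-- The **Dugundji extension theorem**: continuous maps from a closed subset of a metrizable space
to a normed space extend to the whole space. -/
theorem exists_continuous_extension_of_isClosed {B : Set Z} (hB : IsClosed B) (f : B → E)
    (hf : Continuous f) : ∃ φ : Z → E, Continuous φ ∧ ∀ b : B, φ b = f b := by
  classical
  let _ : MetricSpace Z := metrizableSpaceMetric Z
  rcases B.eq_empty_or_nonempty with rfl | hne
  · exact ⟨fun _ => 0, continuous_const, fun b => b.2.elim⟩
  have hpos : ∀ z : (Bᶜ : Set Z), 0 < infDist (z : Z) B := fun z =>
    (hB.notMem_iff_infDist_pos hne).1 z.2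
  -- The factor 2 leaves room: a point of `B` admissible for `z` stays admissible nearby, so
  -- constants are local selections.
  obtain ⟨g, hg⟩ := exists_continuous_forall_mem_convex_of_local_const
    (t := fun z : (Bᶜ : Set Z) =>
      convexHull ℝ (f '' {b : B | dist (z : Z) b < 2 * infDist (z : Z) B}))
    (fun z => convex_convexHull ℝ _) (fun z => by
      obtain ⟨b, hb, hzb⟩ := (infDist_lt_iff hne).1
        (show infDist (z : Z) B < 2 * infDist (z : Z) B by linarith [hpos z])
      refine ⟨f ⟨b, hb⟩, ?_⟩
      have h1 : Continuous fun y : (Bᶜ : Set Z) => dist (y : Z) b := by fun_prop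
      have h2 : Continuous fun y : (Bᶜ : Set Z) => 2 * infDist (y : Z) B :=
        continuous_const.mul ((continuous_infDist_pt B).comp continuous_subtype_val)
      filter_upwards [h1.continuousAt.eventually_lt h2.continuousAt hzb] with y hy
      exact subset_convexHull ℝ _ ⟨⟨b, hb⟩, hy, rfl⟩)
  refine ⟨fun z => if h : z ∈ B then f ⟨z, h⟩ else g ⟨z, h⟩, ?_, fun b => by simp⟩
  rw [continuous_iff_continuousAt]
  intro z
  by_cases hz : z ∈ B
  · rw [Metric.continuousAt_iff]
    intro ε hε
    obtain ⟨δ, hδ, hfδ⟩ := Metric.continuousAt_iff.1 (hf.continuousAt (x := ⟨z, hz⟩)) ε hε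
    -- Points of `B` used at `y` lie within `2 * infDist y B + dist y z ≤ 3 * dist y z` of `z`.
    refine ⟨δ / 3, by positivity, fun y hy => ?_⟩
    by_cases hyB : y ∈ B
    · simp only [hyB, hz, dif_pos]
      exact hfδ (lt_of_lt_of_le (by exact hy) (by linarith))
    · simp only [hyB, hz, dif_pos, dif_neg, not_false_eq_true]
      refine convexHull_min ?_ (convex_ball (f ⟨z, hz⟩) ε) (hg ⟨y, hyB⟩)
      rintro _ ⟨b, hb, rfl⟩
      refine hfδ ?_
      have h1 : infDist y B ≤ dist y z := infDist_le_dist_of_mem hz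
      have h2 : dist (b : Z) z ≤ dist y b + dist y z := dist_triangle_left _ _ _
      have hb' : dist y (b : Z) < 2 * infDist y B := hb
      change dist (b : Z) z < δ
      linarith
  · have ho : IsOpen Bᶜ := hB.isOpen_compl
    refine ContinuousOn.continuousAt (s := Bᶜ) ?_ (ho.mem_nhds hz)
    rw [continuousOn_iff_continuous_domRestrict]
    convert g.continuous using 1
    ext y
    exact dif_neg y.2

end Dugundji

/-- Every metrizable space embeds in a Banach space. -/
theorem exists_isEmbedding_boundedContinuousFunction (X : Type*) [TopologicalSpace X]
    [MetrizableSpace X] : ∃ k : X → (X →ᵇ ℝ), IsEmbedding k := by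
  let _ : MetricSpace X := metrizableSpaceMetric X
  -- Truncating at 1 makes the distance functions bounded and leaves small distances unchanged.
  let k : X → (X →ᵇ ℝ) := fun x => BoundedContinuousFunction.ofNormedAddCommGroup
    (fun y => min 1 (dist x y)) (by fun_prop) 1 (fun y => by
      rw [Real.norm_of_nonneg (le_min zero_le_one dist_nonneg)]
      exact min_le_left _ _)
  have hk : ∀ x y, k x y = min 1 (dist x y) := fun _ _ => rfl
  have hle : ∀ x x', dist (k x) (k x') ≤ dist x x' := fun x x' => by
    rw [BoundedContinuousFunction.dist_le dist_nonneg]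
    intro y
    rw [hk, hk, Real.dist_eq]
    have := abs_dist_sub_le x x' y
    refine (abs_min_sub_min_le_max 1 (dist x y) 1 (dist x' y)).trans ?_
    simpa using this
  have hge : ∀ x x', min 1 (dist x x') ≤ dist (k x) (k x') := fun x x' => by
    have := BoundedContinuousFunction.dist_coe_le_dist (f := k x) (g := k x') x'
    rw [hk, hk, Real.dist_eq, dist_self, min_eq_right (zero_le_one' ℝ), sub_zero] at this
    exact (le_abs_self _).trans this
  refine ⟨k, ?_⟩
  refine IsUniformEmbedding.isEmbedding
    (isUniformEmbedding_iff'.2 ⟨fun ε hε => ⟨ε, hε, fun h => (hle _ _).trans_lt h⟩,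
      fun δ hδ => ⟨min 1 δ, by positivity, fun {a b} h => ?_⟩⟩)
  have h1 := (hge a b).trans_lt h
  by_contra! h2
  exact absurd h1 (not_lt.2 (min_le_min_left 1 h2))

/-! ### Coinduced `G`-spaces -/

/-- The space of continuous maps from `G` to `E`, as a `G`-space under right translations. -/
def Coinduced (G E : Type*) [TopologicalSpace G] [TopologicalSpace E] : Type _ := C(G, E)

namespace Coinduced

variable {G E : Type*} [TopologicalSpace G] [TopologicalSpace E]

instance : TopologicalSpace (Coinduced G E) := inferInstanceAs (TopologicalSpace C(G, E))

instance : FunLike (Coinduced G E) G E := inferInstanceAs (FunLike C(G, E) G E)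

instance [CompactSpace G] [MetrizableSpace E] : MetrizableSpace (Coinduced G E) :=
  inferInstanceAs (MetrizableSpace C(G, E))

instance [Group G] [IsTopologicalGroup G] : MulAction G (Coinduced G E) where
  smul h ξ := ContinuousMap.comp (ξ : C(G, E)) ⟨fun g => g * h, by fun_prop⟩
  one_smul ξ := DFunLike.ext _ _ fun g => congrArg ξ (mul_one g)
  mul_smul a b ξ := DFunLike.ext _ _ fun g => congrArg ξ (mul_assoc g a b).symm

theorem smul_apply [Group G] [IsTopologicalGroup G] (h : G) (ξ : Coinduced G E) (g : G) :
    (h • ξ) g = ξ (g * h) := rfl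

theorem continuous_eval [LocallyCompactSpace G] :
    Continuous fun p : Coinduced G E × G => p.1 p.2 :=
  ContinuousEval.continuous_eval (F := C(G, E))

theorem continuous_of_continuous_uncurry {W : Type*} [TopologicalSpace W] {F : W → Coinduced G E}
    (h : Continuous fun p : W × G => F p.1 p.2) : Continuous F :=
  ContinuousMap.continuous_of_continuous_uncurry (Y := G) (Z := E) F h

instance [Group G] [IsTopologicalGroup G] [LocallyCompactSpace G] :
    ContinuousSMul G (Coinduced G E) where
  continuous_smul := continuous_of_continuous_uncurry <|
    continuous_eval.comp (f := fun p : (G × Coinduced G E) × G => (p.1.2, p.2 * p.1.1))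
      (by fun_prop)

/-- The `G`-map to the coinduced space adjoint to a continuous map `φ : W → E`. -/
def lift [Group G] [IsTopologicalGroup G] {W : Type*} [TopologicalSpace W] [MulAction G W]
    [ContinuousSMul G W] (φ : C(W, E)) : W →[G] Coinduced G E where
  toFun w := (⟨fun g => φ (g • w), by fun_prop⟩ : C(G, E))
  map_smul' h w := DFunLike.ext _ _ fun g => congrArg φ (mul_smul g h w).symm

section lift

variable [Group G] [IsTopologicalGroup G] {W : Type*} [TopologicalSpace W] [MulAction G W]
  [ContinuousSMul G W]

theorem lift_apply (φ : C(W, E)) (w : W) (g : G) : lift φ w g = φ (g • w) := rfl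

theorem continuous_lift (φ : C(W, E)) : Continuous (lift (G := G) φ) :=
  continuous_of_continuous_uncurry <|
    φ.continuous.comp (f := fun p : W × G => p.2 • p.1) (by fun_prop)

/-- Evaluation at `1 : G` recovers `φ` from its lift. -/
theorem isEmbedding_lift [LocallyCompactSpace G] {φ : C(W, E)} (hφ : IsEmbedding φ) :
    IsEmbedding (lift (G := G) φ) := by
  refine IsEmbedding.of_comp (continuous_lift φ)
    (g := fun ξ : Coinduced G E => ξ 1)
    (continuous_eval.comp (continuous_id.prodMk continuous_const)) ?_
  convert hφ using 1
  ext w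
  simp [lift_apply]

end lift

end Coinduced

/-! ### Invariant functions and equivariant images -/

/-- A closed invariant subset of a metrizable `G`-space is the zero set of an invariant continuous
function to `[0, 1]`, when `G` is compact. -/
theorem SubMulAction.exists_invariant_zeroSet {G : Type*} [Group G] [TopologicalSpace G]
    [IsTopologicalGroup G] [CompactSpace G] {Z : Type*} [TopologicalSpace Z] [MetrizableSpace Z]
    [MulAction G Z] [ContinuousSMul G Z] (B : SubMulAction G Z) (hB : IsClosed (B : Set Z)) :
    ∃ t : Z → unitInterval, Continuous t ∧ (∀ (g : G) z, t (g • z) = t z) ∧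
      ∀ z, t z = 0 ↔ z ∈ B := by
  let _ : MetricSpace Z := metrizableSpaceMetric Z
  obtain ⟨τ, hτB, hτ⟩ :=
    perfectlyNormalSpace_iff_forall_isClosed_preimage_zero.1 inferInstance _ hB
  have hmem : ∀ z, z ∈ B ↔ τ z = 0 := fun z => by
    rw [← SetLike.mem_coe, hτB]; rfl
  -- The sup norm of `ξ z` is the maximum of `τ` on the orbit of `z`: it is invariant, and
  -- continuous since `ξ` is.
  let ξ : Z → C(G, ℝ) := Coinduced.lift τ
  have hξ : ∀ z g, ξ z g = τ (g • z) := fun _ _ => rfl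
  have hc : Continuous ξ := Coinduced.continuous_lift τ
  have hle : ∀ (h : G) z, ‖ξ (h • z)‖ ≤ ‖ξ z‖ := fun h z => by
    rw [ContinuousMap.norm_le _ (norm_nonneg _)]
    intro g
    rw [hξ, ← mul_smul, ← hξ]
    exact (ξ z).norm_coe_le_norm _
  refine ⟨fun z => ⟨‖ξ z‖, norm_nonneg _, ?_⟩, by fun_prop, fun g z => ?_, fun z => ?_⟩
  · rw [ContinuousMap.norm_le _ zero_le_one]
    intro g
    rw [hξ, Real.norm_of_nonneg (hτ _).1]
    exact (hτ _).2
  · refine Subtype.ext (le_antisymm (hle g z) ?_)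
    simpa using hle g⁻¹ (g • z)
  · rw [Subtype.ext_iff]
    change ‖ξ z‖ = 0 ↔ _
    rw [norm_eq_zero]
    constructor
    · intro h
      have := hξ z 1
      rw [h, one_smul] at this
      exact (hmem z).2 this.symm
    · intro h
      ext g
      rw [hξ]
      exact (hmem _).1 (B.smul_mem g h)

/-- The image of an equivariant map from a `G`-set in `Type u` to a metrizable `G`-space has a model
in `Type u`. -/
theorem MulActionHom.exists_small_image {G : Type v} [Group G] [TopologicalSpace G]
    {W : Type u} [MulAction G W] {T : Type*} [TopologicalSpace T] [MetrizableSpace T]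
    [MulAction G T] [ContinuousSMul G T] (j : W →[G] T) :
    ∃ (Y : Type u) (_ : TopologicalSpace Y) (_ : MetrizableSpace Y) (_ : MulAction G Y)
      (_ : ContinuousSMul G Y) (e : Y →[G] T) (q : W →[G] Y),
      IsEmbedding e ∧ Function.Surjective q ∧ ∀ w, e (q w) = j w := by
  let S : SubMulAction G T :=
    { carrier := range j
      smul_mem' := by
        rintro g _ ⟨w, rfl⟩
        exact ⟨g • w, map_smul j g w⟩ }
  -- The test spaces of `IsGAR` live in `Type u`, while coinduced spaces also involve the universe
  -- of `G`.
  have : Small.{u} S := inferInstanceAs (Small.{u} (range j))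
  let e : Shrink.{u} S →[G] T :=
    { toFun := fun y => ((equivShrink S).symm y : T)
      map_smul' := fun g y => by simp }
  have he : IsEmbedding e := IsEmbedding.subtypeVal.comp (Shrink.homeomorph S).symm.isEmbedding
  have hq : ∀ w, e (equivShrink S ⟨j w, w, rfl⟩) = j w := fun w =>
    congrArg Subtype.val ((equivShrink S).symm_apply_apply _)
  let q : W →[G] Shrink.{u} S :=
    { toFun := fun w => equivShrink S ⟨j w, w, rfl⟩
      map_smul' := fun g w => he.injective (by
        rw [hq, map_smul e, hq]
        exact map_smul j g w) }
  refine ⟨Shrink.{u} S, inferInstance, he.metrizableSpace, inferInstance,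
    he.isInducing.continuousSMul continuous_id (fun {c x} => map_smul e c x), e, q, he, ?_, hq⟩
  intro y
  obtain ⟨w, hw⟩ := ((equivShrink S).symm y).2
  exact ⟨w, he.injective ((hq w).trans hw)⟩

/-- A `G`-embedding has a continuous equivariant inverse on its image. -/
theorem exists_inverse_gImage {G : Type v} [Group G] {X : Type u} [TopologicalSpace X]
    [MulAction G X] {Y : Type u} [TopologicalSpace Y] [MulAction G Y] (i : X →[G] Y)
    (hi : IsEmbedding i) :
    ∃ p : gImage i →[G] X, Continuous p ∧ (∀ y, i (p y) = y) ∧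
      ∀ (y : gImage i) x, (y : Y) = i x → p y = x := by
  let p : gImage i → X := fun y => y.2.choose
  have hp : ∀ y, i (p y) = y := fun y => y.2.choose_spec
  refine ⟨⟨p, fun g y => hi.injective ?_⟩, hi.isInducing.continuous_iff.2 ?_, hp,
    fun y x h => hi.injective ((hp y).trans h)⟩
  · rw [hp, map_smul i, id, hp]
    rfl
  · convert continuous_subtype_val (p := (· ∈ gImage i)) using 1
    exact funext hp

/-! ### Extending equivariant maps into `G`-ARs and `G`-ANRs -/

section Extension

variable {G : Type v} [Group G] [TopologicalSpace G] [IsTopologicalGroup G] [CompactSpace G]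
  {X : Type u} [TopologicalSpace X] [MetrizableSpace X] [MulAction G X] [ContinuousSMul G X]

/-- Every `G`-map from a closed invariant subset of `Z` to `X` extends to a `G`-map from `Z` to some
metrizable `G`-space containing `X` as a closed invariant subset. -/
theorem exists_isClosedEmbedding_extension {Z : Type u} [TopologicalSpace Z] [MetrizableSpace Z]
    [MulAction G Z] [ContinuousSMul G Z] (B : SubMulAction G Z) (hB : IsClosed (B : Set Z))
    (f : B →[G] X) (hf : Continuous f) :
    ∃ (Y : Type u) (_ : TopologicalSpace Y) (_ : MetrizableSpace Y) (_ : MulAction G Y)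
      (_ : ContinuousSMul G Y) (i : X →[G] Y) (Φ : Z →[G] Y),
      IsClosedEmbedding i ∧ Continuous Φ ∧ ∀ b : B, Φ (b : Z) = i (f b) := by
  obtain ⟨k, hk⟩ := exists_isEmbedding_boundedContinuousFunction X
  obtain ⟨φ, hφ, hφB⟩ := exists_continuous_extension_of_isClosed hB (k ∘ f)
    (hk.continuous.comp hf)
  obtain ⟨t, ht, htG, htB⟩ := B.exists_invariant_zeroSet hB
  let κ : C(X, (X →ᵇ ℝ) × unitInterval) :=
    ⟨fun x => (k x, 0), hk.continuous.prodMk continuous_const⟩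
  have hκ : IsEmbedding κ := (isEmbedding_prodMkLeft 0).comp hk
  let ψ : C(Z, (X →ᵇ ℝ) × unitInterval) := ⟨fun z => (φ z, t z), hφ.prodMk ht⟩
  let j : X ⊕ Z →[G] Coinduced G ((X →ᵇ ℝ) × unitInterval) :=
    { toFun := Sum.elim (Coinduced.lift κ) (Coinduced.lift ψ)
      map_smul' := by
        rintro g (x | z)
        exacts [map_smul (Coinduced.lift κ) g x, map_smul (Coinduced.lift ψ) g z] }
  -- The two lifts agree along `f`, because `B` is invariant and `φ` extends `k ∘ f`.
  have hψκ : ∀ b : B, Coinduced.lift (G := G) ψ (b : Z) = Coinduced.lift κ (f b) := fun b => by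
    refine DFunLike.ext _ _ fun g => Prod.ext ?_ ((htB _).2 (B.smul_mem g b.2))
    change φ (((g • b : B)) : Z) = k (g • f b)
    rw [hφB, ← map_smul f]
    rfl
  obtain ⟨Y, _, _, _, _, e, q, he, hq, hqe⟩ := j.exists_small_image
  let i : X →[G] Y := ⟨fun x => q (.inl x), fun g x => map_smul q g (.inl x)⟩
  let Φ : Z →[G] Y := ⟨fun z => q (.inr z), fun g z => map_smul q g (.inr z)⟩
  have hei : ∀ x, e (i x) = Coinduced.lift κ x := fun x => hqe (.inl x)
  have heΦ : ∀ z, e (Φ z) = Coinduced.lift ψ z := fun z => hqe (.inr z)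
  have hΦi : ∀ b : B, Φ (b : Z) = i (f b) := fun b =>
    he.injective (by rw [heΦ, hei, hψκ])
  have heic : e ∘ i = Coinduced.lift κ := funext hei
  have hemb : IsEmbedding (e ∘ i) := heic ▸ Coinduced.isEmbedding_lift hκ
  have hi : Continuous i := he.isInducing.continuous_iff.2 hemb.continuous
  have hΦ : Continuous Φ := he.isInducing.continuous_iff.2
    ((funext heΦ : e ∘ Φ = Coinduced.lift ψ) ▸ Coinduced.continuous_lift ψ)
  refine ⟨Y, _, ‹_›, _, ‹_›, i, Φ, ⟨IsEmbedding.of_comp hi he.continuous hemb, ?_⟩, hΦ, hΦi⟩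
  -- The extra coordinate cuts out `X`: a point of `Z` where it vanishes lies in `B`, and so has its
  -- image in `X`.
  have hrange : range i = (fun y => (e y 1).2) ⁻¹' {0} := by
    ext y
    constructor
    · rintro ⟨x, rfl⟩
      change (e (i x) 1).2 = 0
      rw [hei]
      rfl
    · intro hy
      obtain ⟨x | z, rfl⟩ := hq y
      · exact ⟨x, rfl⟩
      · have h0 : (e (Φ z) 1).2 = 0 := hy
        rw [heΦ, Coinduced.lift_apply, one_smul] at h0
        exact ⟨f ⟨z, (htB z).1 h0⟩, (hΦi ⟨z, (htB z).1 h0⟩).symm⟩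
  rw [hrange]
  exact isClosed_singleton.preimage (continuous_snd.comp
    (Coinduced.continuous_eval.comp (he.continuous.prodMk continuous_const)))

theorem IsGAR.exists_extension (hX : IsGAR G X) {Z : Type u} [TopologicalSpace Z]
    [MetrizableSpace Z] [MulAction G Z] [ContinuousSMul G Z] (B : SubMulAction G Z)
    (hB : IsClosed (B : Set Z)) (f : B →[G] X) (hf : Continuous f) :
    ∃ F : Z →[G] X, Continuous F ∧ ∀ b : B, F (b : Z) = f b := by
  obtain ⟨Y, _, _, _, _, i, Φ, hi, hΦ, hΦi⟩ := exists_isClosedEmbedding_extension B hB f hf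
  obtain ⟨r, hr, hri⟩ := hX Y i hi
  obtain ⟨p, hp, -, hpi⟩ := exists_inverse_gImage i hi.isEmbedding
  refine ⟨p.comp (r.comp Φ), hp.comp (hr.comp hΦ), fun b => ?_⟩
  change p (r (Φ b)) = f b
  rw [hΦi, hri ⟨i (f b), f b, rfl⟩]
  exact hpi _ _ rfl

theorem IsGANR.exists_extension (hX : IsGANR G X) {Z : Type u} [TopologicalSpace Z]
    [MetrizableSpace Z] [MulAction G Z] [ContinuousSMul G Z] (B : SubMulAction G Z)
    (hB : IsClosed (B : Set Z)) (f : B →[G] X) (hf : Continuous f) :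
    ∃ U : SubMulAction G Z, (U : Set Z) ∈ 𝓝ˢ (B : Set Z) ∧ ∃ F : U →[G] X, Continuous F ∧
      ∀ (z : Z) (hU : z ∈ U) (hB : z ∈ B), F ⟨z, hU⟩ = f ⟨z, hB⟩ := by
  obtain ⟨Y, _, _, _, _, i, Φ, hi, hΦ, hΦi⟩ := exists_isClosedEmbedding_extension B hB f hf
  obtain ⟨V, hV, r, hr, hri⟩ := hX Y i hi
  obtain ⟨p, hp, -, hpi⟩ := exists_inverse_gImage i hi.isEmbedding
  let U : SubMulAction G Z :=
    { carrier := Φ ⁻¹' V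
      smul_mem' := fun g z hz => by
        change Φ (g • z) ∈ V
        rw [map_smul Φ]
        exact V.smul_mem g hz }
  let ΦU : U →[G] V := ⟨fun z => ⟨Φ z, z.2⟩, fun g z => Subtype.ext (map_smul Φ g (z : Z))⟩
  have hΦU : Continuous ΦU := (hΦ.comp continuous_subtype_val).subtype_mk _
  refine ⟨U, ?_, p.comp (r.comp ΦU), hp.comp (hr.comp hΦU), fun z hU hzB => ?_⟩
  · rw [mem_nhdsSet_iff_forall] at hV ⊢
    intro z hz
    refine hΦ.continuousAt.preimage_mem_nhds (hV _ ?_)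
    rw [hΦi ⟨z, hz⟩]
    exact ⟨_, rfl⟩
  · change p (r ⟨Φ z, hU⟩) = _
    have h : Φ z = i (f ⟨z, hzB⟩) := hΦi ⟨z, hzB⟩
    rw [hri (Φ z) hU (h ▸ ⟨_, rfl⟩)]
    exact hpi _ _ h

end Extension

/-! ### Pairs and homotopy density -/

section Pairs

variable {G : Type v} [Group G] [TopologicalSpace G]
  {X : Type u} [TopologicalSpace X] [MulAction G X] {A : SubMulAction G X}

theorem IsGARPair.isGAR (h : IsGARPair A) : IsGAR G X := by
  intro Y _ _ _ _ i hi
  obtain ⟨p, hp, hip, -⟩ := exists_inverse_gImage i hi.isEmbedding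
  obtain ⟨F, hF, hFp, -⟩ := h Y (gImage i) hi.isClosed_range p hp
  refine ⟨⟨fun y => ⟨i (F y), F y, rfl⟩, fun g y => Subtype.ext ?_⟩,
    (hi.continuous.comp hF).subtype_mk _, fun a => Subtype.ext ?_⟩
  · change i (F (g • y)) = g • i (F y)
    rw [map_smul F, map_smul i]
  · change i (F a) = a
    rw [hFp, hip]

theorem IsGANRPair.isGANR (h : IsGANRPair A) : IsGANR G X := by
  intro Y _ _ _ _ i hi
  obtain ⟨p, hp, hip, -⟩ := exists_inverse_gImage i hi.isEmbedding
  obtain ⟨U, hU, F, hF, hFp, -⟩ := h Y (gImage i) hi.isClosed_range p hp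
  refine ⟨U, hU, ⟨fun y => ⟨i (F y), F y, rfl⟩, fun g y => Subtype.ext ?_⟩,
    (hi.continuous.comp hF).subtype_mk _, fun y hyU hyA => Subtype.ext ?_⟩
  · change i (F (g • y)) = g • i (F y)
    rw [map_smul F, map_smul i]
  · change i (F ⟨y, hyU⟩) = y
    rw [hFp y hyU hyA, hip]

theorem IsGARPair.isGANRPair (h : IsGARPair A) : IsGANRPair A := by
  intro Z _ _ _ _ B hB f hf
  obtain ⟨F, hF, hFf, hFA⟩ := h Z B hB f hf
  exact ⟨⊤, Filter.univ_mem, F.comp (SubMulAction.subtype ⊤), hF.comp continuous_subtype_val,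
    fun z _ hz => hFf ⟨z, hz⟩, fun z hz => hFA z hz⟩

theorem IsGANRPair.isGHomotopyDense [IsTopologicalGroup G] [CompactSpace G] [MetrizableSpace X]
    [ContinuousSMul G X] (h : IsGANRPair A) : IsGHomotopyDense A := by
  let _ : MulAction G unitInterval :=
    { smul := fun _ s => s
      one_smul := fun _ => rfl
      mul_smul := fun _ _ _ => rfl }
  have : ContinuousSMul G unitInterval := ⟨continuous_snd⟩
  have hsmul : ∀ (g : G) (x : X) (s : unitInterval), g • (x, s) = (g • x, s) :=
    fun _ _ _ => rfl
  let B : SubMulAction G (X × unitInterval) :=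
    { carrier := {z | z.2 = 0}
      smul_mem' := fun _ _ hz => hz }
  have hB : IsClosed (B : Set (X × unitInterval)) := isClosed_singleton.preimage continuous_snd
  obtain ⟨U, hU, F, hF, hFB, hFA⟩ := h (X × unitInterval) B hB
    ⟨fun b => (b : X × unitInterval).1, fun _ _ => rfl⟩
    (continuous_fst.comp continuous_subtype_val)
  -- an invariant function that is positive on `B` and vanishes outside `U`
  let C : SubMulAction G (X × unitInterval) :=
    { carrier := (interior (U : Set (X × unitInterval)))ᶜ
      smul_mem' := fun g z hz hgz => hz <| by
        have hg : IsOpen ((g • ·) ⁻¹' interior (U : Set (X × unitInterval))) :=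
          isOpen_interior.preimage (continuous_const_smul g)
        refine interior_maximal (fun w hw => ?_) hg hgz
        have := U.smul_mem g⁻¹ (interior_subset hw)
        rwa [inv_smul_smul] at this }
  obtain ⟨t, ht, htG, htC⟩ := C.exists_invariant_zeroSet isOpen_interior.isClosed_compl
  have htU : ∀ z, t z ≠ 0 → z ∈ U := fun z hz => by
    by_contra hzU
    exact hz ((htC z).2 fun hi => hzU (interior_subset hi))
  have htB : ∀ x, t (x, 0) ≠ 0 := fun x h0 =>
    (htC _).1 h0 (mem_interior_iff_mem_nhds.2 (mem_nhdsSet_iff_forall.1 hU (x, 0) rfl))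
  -- the sets `{x} × [0, α x)` lie in `U`
  let m : X → unitInterval → unitInterval := fun x s => max s (t (x, s))
  have hm : Continuous (Function.uncurry m) := by
    change Continuous fun p : X × unitInterval => max p.2 (t (p.1, p.2))
    fun_prop
  let α : X → unitInterval := fun x => sInf (m x '' univ)
  have hα : Continuous α := isCompact_univ.continuous_sInf hm
  have hαG : ∀ (g : G) x, α (g • x) = α x := fun g x => by
    have : m (g • x) = m x := funext fun s => by
      change max s (t (g • (x, s))) = max s (t (x, s))
      rw [htG]
    simp only [α, this]
  have hαle : ∀ x s, α x ≤ max s (t (x, s)) := fun x s => sInf_le ⟨s, trivial, rfl⟩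
  -- The infimum is attained; at `s = 0` the second term of the maximum is positive, elsewhere the
  -- first is.
  have hα0 : ∀ x, 0 < α x := fun x => by
    obtain ⟨s, -, hs⟩ := isCompact_univ.exists_sInf_image_eq (univ_nonempty)
      (f := m x) (hm.comp (by fun_prop : Continuous fun s => (x, s))).continuousOn
    change 0 < sInf (m x '' univ)
    rw [hs]
    rcases eq_or_ne s 0 with rfl | h0
    · exact lt_max_of_lt_right (unitInterval.pos_iff_ne_zero.2 (htB x))
    · exact lt_max_of_lt_left (unitInterval.pos_iff_ne_zero.2 h0)
  -- Halving keeps the rescaled time strictly below `α` even at time 1.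
  let c : unitInterval := ⟨1 / 2, by norm_num, by norm_num⟩
  let β : X × unitInterval → unitInterval := fun z => z.2 * (c * α z.1)
  have hβ : Continuous β := by fun_prop
  have hβα : ∀ z, β z < α z.1 := fun z => by
    have h1 : (0 : ℝ) < α z.1 := hα0 z.1
    have h2 : (z.2 : ℝ) ≤ 1 := z.2.2.2
    change (z.2 : ℝ) * (1 / 2 * α z.1) < α z.1
    nlinarith
  have hβU : ∀ z, (z.1, β z) ∈ U := fun z => htU _ fun h0 => by
    have := hαle z.1 (β z)
    rw [h0, max_eq_left unitInterval.nonneg'] at this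
    exact this.not_gt (hβα z)
  refine ⟨fun z => F ⟨(z.1, β z), hβU z⟩,
    hF.comp ((continuous_fst.prodMk hβ).subtype_mk _), fun g x s => ?_, fun x => ?_,
    fun x s hs => ?_⟩
  · rw [← map_smul F]
    refine congrArg F (Subtype.ext (Prod.ext rfl ?_))
    change s * (c * α (g • x)) = s * (c * α x)
    rw [hαG]
  · have h0 : β (x, 0) = 0 := zero_mul _
    exact (hFB _ (hβU (x, 0)) h0)
  · refine hFA _ fun h0 => ?_
    have h1 : (0 : ℝ) < α x := hα0 x
    have h2 : (0 : ℝ) < s := hs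
    have h3 : (s : ℝ) * (1 / 2 * α x) = 0 := congrArg Subtype.val h0
    have : (0 : ℝ) < s * (1 / 2 * α x) := by positivity
    linarith

theorem IsGAR.isGARPair [IsTopologicalGroup G] [CompactSpace G] [MetrizableSpace X]
    [ContinuousSMul G X] (h : IsGAR G X) (hA : IsGHomotopyDense A) : IsGARPair A := by
  intro Z _ _ _ _ B hB f hf
  obtain ⟨F, hF, hFf⟩ := h.exists_extension B hB f hf
  obtain ⟨t, ht, htG, htB⟩ := B.exists_invariant_zeroSet hB
  obtain ⟨H, hH, hHG, hH0, hHA⟩ := hA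
  refine ⟨⟨fun z => H (F z, t z), fun g z => ?_⟩, hH.comp (hF.prodMk ht), fun b => ?_,
    fun z hz => hHA _ _ (unitInterval.pos_iff_ne_zero.2 fun h0 => hz ((htB z).1 h0))⟩
  · rw [map_smul F, htG]
    exact hHG _ _ _
  · change H (F b, t b) = f b
    rw [(htB b).2 b.2, hH0, hFf]

theorem IsGANR.isGANRPair [IsTopologicalGroup G] [CompactSpace G] [MetrizableSpace X]
    [ContinuousSMul G X] (h : IsGANR G X) (hA : IsGHomotopyDense A) : IsGANRPair A := by
  intro Z _ _ _ _ B hB f hf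
  obtain ⟨U, hU, F, hF, hFf⟩ := h.exists_extension B hB f hf
  obtain ⟨t, ht, htG, htB⟩ := B.exists_invariant_zeroSet hB
  obtain ⟨H, hH, hHG, hH0, hHA⟩ := hA
  refine ⟨U, hU, ⟨fun z => H (F z, t z), fun g z => ?_⟩,
    hH.comp (hF.prodMk (ht.comp continuous_subtype_val)), fun z hzU hzB => ?_,
    fun z hz => hHA _ _ (unitInterval.pos_iff_ne_zero.2 fun h0 => hz ((htB z).1 h0))⟩
  · rw [map_smul F, SubMulAction.val_smul, htG]
    exact hHG _ _ _
  · change H (F ⟨z, hzU⟩, t z) = f ⟨z, hzB⟩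
    rw [(htB z).2 hzB, hH0, hFf z hzU hzB]

end Pairs

theorem theorem3p3 {G : Type v} [Group G] [TopologicalSpace G] [IsTopologicalGroup G]
    [T2Space G] [CompactSpace G]
    {X : Type u} [TopologicalSpace X] [MetrizableSpace X] [MulAction G X] [ContinuousSMul G X]
    (A : SubMulAction G X) :
    (IsGARPair A ↔ IsGAR G X ∧ IsGHomotopyDense A) ∧
      (IsGANRPair A ↔ IsGANR G X ∧ IsGHomotopyDense A) :=
  ⟨⟨fun h => ⟨h.isGAR, h.isGANRPair.isGHomotopyDense⟩, fun h => h.1.isGARPair h.2⟩,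
    ⟨fun h => ⟨h.isGANR, h.isGHomotopyDense⟩, fun h => h.1.isGANRPair h.2⟩⟩
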